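/- Let $\mathfrak g$ be a nonzero complex Lie algebra (not necessarily finite-dimensional) with $[\mathfrak g,\mathfrak g]=\mathfrak g$, equipped with a nondegenerate symmetric invariant bilinear form $\langle\cdot,\cdot\rangle$. Let $\hat{\mathfrak g}=\mathfrak g\otimes\mathbb C[t,t^{-1}]\oplus\mathbb C\mathbf k$ be the affine Lie algebra, in which $\mathbf k$ is central and $$[a\otimes t^m,b\otimes t^n]=[a,b]\otimes t^{m+n}+m\langle a,b\rangle\delta_{m+n,0}\,\mathbf k\qquad(a,b\in\mathfrak g,\ m,n\in\mathbb Z).$$ For a $\hat{\mathfrak g}$-module $W$, $a\in\mathfrak g$ and $w\in W$ put $a(x)w=\sum_{n\in\mathbb Z}(a\otimes t^n)w\,x^{-n-1}\in W[[x,x^{-1}]]$. The module $W$ belongs to the category $\mathcal E$ if there is a nonzero polynomial $p(x)\in\mathbb C[x]$ such that $p(x)a(x)w=0$ for all $a\in\mathfrak g$, $w\in W$. For a $\mathfrak g$-module $U$ and $z\in\mathbb C\setminus\{0\}$, let $U(z)$ be the $\hat{\mathfrak g}$-module with underlying space $U$ on which $a\otimes t^n$ acts as $z^n a$ and $\mathbf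 k$ acts as $0$. Then every finite-dimensional irreducible $\hat{\mathfrak g}$-module $W$ in the category $\mathcal E$ is isomorphic, as a $\hat{\mathfrak g}$-module, to a tensor product $U_1(z_1)\otimes\cdots\otimes U_r(z_r)$ for some $r\ge 1$, some finite-dimensional $\mathfrak g$-modules $U_1,\dots,U_r$ and some distinct nonzero complex numbers $z_1,\dots,z_r$. -/

import Mathlib

open scoped TensorProduct

universe u v w

attribute [local instance 100] LieRing.ofAssociativeRing

noncomputable section

namespace AffineLie

section Affine

variable {g : Type u} [LieRing g] [LieAlgebra ℂ g]

/-- The 2-cocycle `(a ⊗ t^m, b ⊗ t^n) ↦ m ⟨a, b⟩ δ_{m+n,0}` on the loop algebra `ℂ[t, t⁻¹] ⊗ g`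
attached to an invariant symmetric bilinear form `Φ = ⟨·, ·⟩` on `g`. Mathlib's residue cocycle is
`n ⟨a, b⟩ δ_{m+n,0}` on these elements, hence the sign. -/
def cocycle (Φ : LinearMap.BilinForm ℂ g) (hinv : Φ.lieInvariant g) (hsymm : Φ.IsSymm) :
    LieModule.Cohomology.twoCocycle ℂ (LieAlgebra.loopAlgebra ℂ ℤ g)
      (TrivialLieModule ℂ (LieAlgebra.loopAlgebra ℂ ℤ g) ℂ) :=
  (-1 : ℂ) • LieAlgebra.LoopAlgebra.twoCocycleOfBilinear ℂ ℤ g Φ hinv hsymm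

/-- The (untwisted) affine Lie algebra `ĝ = g ⊗ ℂ[t, t⁻¹] ⊕ ℂ k`. -/
abbrev Affine (Φ : LinearMap.BilinForm ℂ g) (hinv : Φ.lieInvariant g) (hsymm : Φ.IsSymm) :
    Type u :=
  LieAlgebra.ofTwoCocycle (cocycle Φ hinv hsymm)

variable (Φ : LinearMap.BilinForm ℂ g) (hinv : Φ.lieInvariant g) (hsymm : Φ.IsSymm)

/-- The element `a ⊗ t^n` of `ĝ`. -/
def loopElt (a : g) (n : ℤ) : Affine Φ hinv hsymm :=
  LieAlgebra.ofProd (cocycle Φ hinv hsymm) (AddMonoidAlgebra.single n 1 ⊗ₜ[ℂ] a, 0)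

/-- The central element `k` of `ĝ`. -/
def central : Affine Φ hinv hsymm :=
  LieAlgebra.ofProd (cocycle Φ hinv hsymm)
    (0, (TrivialLieModule.equiv ℂ (LieAlgebra.loopAlgebra ℂ ℤ g) ℂ).symm 1)

/-- The defining commutator relation
`[a ⊗ t^m, b ⊗ t^n] = [a, b] ⊗ t^(m+n) + m ⟨a, b⟩ δ_{m+n,0} k`. -/
theorem lie_loopElt (a b : g) (m n : ℤ) :
    ⁅loopElt Φ hinv hsymm a m, loopElt Φ hinv hsymm b n⁆ =
      loopElt Φ hinv hsymm ⁅a, b⁆ (m + n) +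
        (if m + n = 0 then (m : ℂ) * Φ a b else 0) • central Φ hinv hsymm := by
  have h : LieAlgebra.LoopAlgebra.residuePairing ℂ ℤ g Φ
      (AddMonoidAlgebra.single m 1 ⊗ₜ[ℂ] a) (AddMonoidAlgebra.single n 1 ⊗ₜ[ℂ] b) =
      -(if m + n = 0 then (m : ℂ) * Φ a b else 0) := by
    rw [LieAlgebra.LoopAlgebra.residuePairing_apply_apply]
    simp only [LieAlgebra.LoopAlgebra.toFinsupp_single_tmul]
    rw [Finsupp.sum_single_index (by simp)]
    split_ifs with hmn
    · obtain rfl : m = -n := by omega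
      simp
    · rw [Finsupp.single_eq_of_ne (by omega)]
      simp
  have hc : ∀ x y, (cocycle Φ hinv hsymm : LieModule.Cohomology.twoCochain ℂ
      (LieAlgebra.loopAlgebra ℂ ℤ g) (TrivialLieModule ℂ (LieAlgebra.loopAlgebra ℂ ℤ g) ℂ)) x y =
      (TrivialLieModule.equiv ℂ (LieAlgebra.loopAlgebra ℂ ℤ g) ℂ).symm
        (-(LieAlgebra.LoopAlgebra.residuePairing ℂ ℤ g Φ x y)) := by
    intro x y
    rw [map_neg, ← neg_one_smul ℂ]
    rfl
  generalize (if m + n = 0 then (m : ℂ) * Φ a b else 0) = c at h ⊢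
  rw [LieAlgebra.bracket_ofTwoCocycle]
  simp only [loopElt, central, Equiv.symm_apply_apply, ← LieAlgebra.of_smul, ← LieAlgebra.of_add]
  congr 1
  refine Prod.ext ?_ ?_
  · simp only [LieAlgebra.ExtendScalars.bracket_tmul, AddMonoidAlgebra.single_mul_single, mul_one,
      Prod.fst_add, Prod.smul_fst, smul_zero, add_zero]
  · simp only [lie_zero, add_zero, sub_zero]
    erw [hc, h]
    simp [← map_smul]

theorem lie_central (X : Affine Φ hinv hsymm) : ⁅X, central Φ hinv hsymm⁆ = 0 := by
  rw [LieAlgebra.bracket_ofTwoCocycle, ← LieAlgebra.of_zero]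
  congr 1
  ext
  · simp [central]
  · simp [central, trivial_lie_zero]

/-- `ĝ` is spanned by the elements `a ⊗ t^n` and `k`. -/
theorem span_eq_top :
    Submodule.span ℂ (insert (central Φ hinv hsymm)
      (Set.range fun x : g × ℤ => loopElt Φ hinv hsymm x.1 x.2)) = ⊤ := by
  set S := Submodule.span ℂ (insert (central Φ hinv hsymm)
      (Set.range fun x : g × ℤ => loopElt Φ hinv hsymm x.1 x.2)) with hS
  have hk : central Φ hinv hsymm ∈ S := Submodule.subset_span (Set.mem_insert _ _)
  have hl (a : g) (n : ℤ) : loopElt Φ hinv hsymm a n ∈ S :=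
    Submodule.subset_span (Set.mem_insert_of_mem _ ⟨(a, n), rfl⟩)
  have h1 (x : LieAlgebra.loopAlgebra ℂ ℤ g) :
      LieAlgebra.ofProd (cocycle Φ hinv hsymm) (x, 0) ∈ S := by
    have key (f : ℤ →₀ g) : LieAlgebra.ofProd (cocycle Φ hinv hsymm)
        ((LieAlgebra.LoopAlgebra.toFinsupp ℂ ℤ g).symm f, 0) ∈ S := by
      induction f using Finsupp.induction_linear with
      | zero =>
        rw [map_zero]
        exact S.zero_mem
      | add f f' hf hf' =>
        rw [map_add]
        simpa [← LieAlgebra.of_add] using S.add_mem hf hf'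
      | single n a =>
        rw [LieAlgebra.LoopAlgebra.toFinsupp_symm_single]
        exact hl a n
    simpa using key (LieAlgebra.LoopAlgebra.toFinsupp ℂ ℤ g x)
  rw [eq_top_iff]
  rintro X -
  obtain ⟨⟨x, c⟩, rfl⟩ := (LieAlgebra.ofProd (cocycle Φ hinv hsymm)).surjective X
  have h2 : LieAlgebra.ofProd (cocycle Φ hinv hsymm) (x, c) =
      LieAlgebra.ofProd (cocycle Φ hinv hsymm) (x, 0) +
        (TrivialLieModule.equiv ℂ (LieAlgebra.loopAlgebra ℂ ℤ g) ℂ c) • central Φ hinv hsymm := by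
    rw [central, ← LieAlgebra.of_smul, ← LieAlgebra.of_add]
    congr 1
    refine Prod.ext (by simp) ?_
    simp [← map_smul]
  rw [h2]
  exact S.add_mem (h1 x) (S.smul_mem _ hk)

section CategoryE

variable {W : Type w} [AddCommGroup W] [Module ℂ W]

/-- The product `p(x) f(x)` of a polynomial `p(x)` and a doubly infinite formal series
`f(x) = ∑ₙ f(n) xⁿ` with coefficients in `W`. -/
def polyMul (p : Polynomial ℂ) (f : ℤ → W) : ℤ → W :=
  fun n => p.sum fun k c => c • f (n - k)

variable [LieRingModule (Affine Φ hinv hsymm) W]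

/-- The formal series `a(x) w = ∑ₙ (a ⊗ tⁿ) w x^(-n-1)`: its coefficient of `x^j` is
`(a ⊗ t^(-j-1)) w`. -/
def genSeries (a : g) (w : W) : ℤ → W :=
  fun j => ⁅loopElt Φ hinv hsymm a (-j - 1), w⁆

variable (W) in
/-- The `ĝ`-module `W` is in the category `ℰ`: there is a nonzero polynomial `p(x)` with
`p(x) a(x) w = 0` for all `a ∈ g` and `w ∈ W`. -/
def InCategoryE : Prop :=
  ∃ p : Polynomial ℂ, p ≠ 0 ∧
    ∀ (a : g) (w : W), polyMul p (genSeries Φ hinv hsymm a w) = 0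

end CategoryE

/-- Evaluation of a Laurent polynomial at a nonzero complex number. -/
def laurentEval (z : ℂˣ) : AddMonoidAlgebra ℂ ℤ →ₐ[ℂ] ℂ :=
  AddMonoidAlgebra.lift ℂ ℂ ℤ ((Units.coeHom ℂ).comp (zpowersHom ℂˣ z))

/-- The projection `ĝ → g ⊗ ℂ[t, t⁻¹]`, sending `k` to `0`. -/
def toLoop : Affine Φ hinv hsymm →ₗ⁅ℂ⁆ LieAlgebra.loopAlgebra ℂ ℤ g :=
  { toFun := fun X => ((LieAlgebra.ofProd (cocycle Φ hinv hsymm)).symm X).1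
    map_add' := fun _ _ => rfl
    map_smul' := fun _ _ => rfl
    map_lie' := rfl }

/-- The evaluation homomorphism `g ⊗ ℂ[t, t⁻¹] → g`, `a ⊗ f(t) ↦ f(z) a`. -/
def loopEval (z : ℂˣ) : LieAlgebra.loopAlgebra ℂ ℤ g →ₗ⁅ℂ⁆ g where
  toLinearMap := TensorProduct.lift ((LinearMap.lsmul ℂ g).comp (laurentEval z).toLinearMap)
  map_lie' := by
    intro x y
    set F := TensorProduct.lift ((LinearMap.lsmul ℂ g).comp (laurentEval z).toLinearMap)
    change F ⁅x, y⁆ = ⁅F x, F y⁆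
    induction x using TensorProduct.induction_on with
    | zero =>
      refine (congrArg F (zero_lie y)).trans ?_
      rw [map_zero, zero_lie]
    | add x x' hx hx' =>
      refine (congrArg F (add_lie x x' y)).trans ?_
      rw [map_add, hx, hx', map_add, add_lie]
    | tmul p a =>
      induction y using TensorProduct.induction_on with
      | zero =>
        refine (congrArg F (lie_zero (p ⊗ₜ[ℂ] a))).trans ?_
        rw [map_zero, lie_zero]
      | add y y' hy hy' =>
        refine (congrArg F (lie_add (p ⊗ₜ[ℂ] a) y y')).trans ?_
        rw [map_add, hy, hy', map_add, lie_add]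
      | tmul q b =>
        simp [F, LieAlgebra.ExtendScalars.bracket_tmul, smul_smul, mul_comm]

/-- The `ĝ`-module `U(z)`: the space `U` on which `a ⊗ t^n` acts as `zⁿ a` and `k` as `0`. -/
def evalRep (z : ℂˣ) (U : Type v) [AddCommGroup U] [Module ℂ U] [LieRingModule g U]
    [LieModule ℂ g U] : Affine Φ hinv hsymm →ₗ⁅ℂ⁆ Module.End ℂ U :=
  (LieModule.toEnd ℂ g U).comp ((loopEval z).comp (toLoop Φ hinv hsymm))

end Affine

section Tensor

variable {L : Type u} [LieRing L] [LieAlgebra ℂ L] {ι : Type w} [DecidableEq ι]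
  {U : ι → Type v} [∀ i, AddCommGroup (U i)] [∀ i, Module ℂ (U i)]

/-- The operator `1 ⊗ ⋯ ⊗ f ⊗ ⋯ ⊗ 1` with `f` in the `i`-th place. -/
def insertOp (i : ι) : Module.End ℂ (U i) →ₗ[ℂ] Module.End ℂ (⨂[ℂ] j, U j) :=
  (PiTensorProduct.mapMultilinear ℂ U U).toLinearMap (fun _ => LinearMap.id) i

theorem insertOp_tprod (i : ι) (f : Module.End ℂ (U i)) (u : ∀ i, U i) :
    insertOp i f (PiTensorProduct.tprod ℂ u) =
      PiTensorProduct.tprod ℂ (Function.update u i (f (u i))) := by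
  change PiTensorProduct.map (Function.update (fun _ => LinearMap.id) i f) _ = _
  rw [PiTensorProduct.map_tprod]
  congr 1
  ext j
  by_cases h : j = i
  · subst h
    simp
  · simp [h]

theorem insertOp_lie (i : ι) (f f' : Module.End ℂ (U i)) :
    insertOp i ⁅f, f'⁆ = ⁅insertOp (U := U) i f, insertOp i f'⁆ := by
  simp only [Ring.lie_def, map_sub]
  congr 1 <;>
  · ext u
    simp [insertOp_tprod]

theorem insertOp_commute {i j : ι} (h : i ≠ j) (f : Module.End ℂ (U i))
    (f' : Module.End ℂ (U j)) : ⁅insertOp (U := U) i f, insertOp j f'⁆ = 0 := by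
  rw [Ring.lie_def, sub_eq_zero]
  ext u
  simp [insertOp_tprod, Function.update_of_ne h, Function.update_of_ne h.symm,
    Function.update_comm h]

theorem sum_insertOp_lie [Fintype ι] (f f' : ∀ i, Module.End ℂ (U i)) :
    ∑ i, insertOp (U := U) i ⁅f i, f' i⁆ =
      ⁅∑ i, insertOp (U := U) i (f i), ∑ i, insertOp i (f' i)⁆ := by
  rw [sum_lie_sum]
  refine Finset.sum_congr rfl fun i _ => ?_
  rw [Finset.sum_eq_single i (fun j _ hj => insertOp_commute hj.symm _ _) (by simp), insertOp_lie]

/-- The tensor product of finitely many representations of a Lie algebra: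
`X (⨂ uⱼ) = ∑ᵢ u₁ ⊗ ⋯ ⊗ X uᵢ ⊗ ⋯ ⊗ uᵣ`. -/
def tensorRep [Fintype ι] (ρ : ∀ i, L →ₗ⁅ℂ⁆ Module.End ℂ (U i)) : L →ₗ⁅ℂ⁆ Module.End ℂ (⨂[ℂ] i, U i) where
  toLinearMap := ∑ i, (insertOp i).comp (ρ i).toLinearMap
  map_lie' := by
    intro X Y
    simp only [AddHom.toFun_eq_coe, LinearMap.coe_toAddHom,
      LinearMap.sum_apply, LinearMap.comp_apply, LieHom.coe_toLinearMap, LieHom.map_lie]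
    exact sum_insertOp_lie (fun i => ρ i X) (fun i => ρ i Y)

theorem tensorRep_tprod [Fintype ι] (ρ : ∀ i, L →ₗ⁅ℂ⁆ Module.End ℂ (U i)) (X : L) (u : ∀ i, U i) :
    tensorRep ρ X (PiTensorProduct.tprod ℂ u) =
      ∑ i, PiTensorProduct.tprod ℂ (Function.update u i (ρ i X (u i))) := by
  change (∑ i, (insertOp i).comp (ρ i).toLinearMap) X _ = _
  simp [LinearMap.sum_apply, insertOp_tprod]

end Tensor

section Evaluation

variable {g : Type u} [LieRing g] [LieAlgebra ℂ g]
  (Φ : LinearMap.BilinForm ℂ g) (hinv : Φ.lieInvariant g) (hsymm : Φ.IsSymm)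

theorem evalRep_loopElt (z : ℂˣ) {U : Type v} [AddCommGroup U] [Module ℂ U] [LieRingModule g U]
    [LieModule ℂ g U] (a : g) (n : ℤ) (x : U) :
    evalRep Φ hinv hsymm z U (loopElt Φ hinv hsymm a n) x = (z : ℂ) ^ n • ⁅a, x⁆ := by
  change ⁅laurentEval z (AddMonoidAlgebra.single n 1) • a, x⁆ = _
  rw [laurentEval, AddMonoidAlgebra.lift_single]
  simp

theorem evalRep_central (z : ℂˣ) {U : Type v} [AddCommGroup U] [Module ℂ U] [LieRingModule g U]
    [LieModule ℂ g U] : evalRep Φ hinv hsymm z U (central Φ hinv hsymm) = 0 := by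
  have h : toLoop Φ hinv hsymm (central Φ hinv hsymm) = 0 := rfl
  simp [evalRep, h]

/-- The evaluation module `U₁(z₁) ⊗ ⋯ ⊗ U_r(z_r)` over `ĝ`. -/
def evaluationModule {r : ℕ} (z : Fin r → ℂˣ) (U : Fin r → Type v) [∀ i, AddCommGroup (U i)]
    [∀ i, Module ℂ (U i)] [∀ i, LieRingModule g (U i)] [∀ i, LieModule ℂ g (U i)] :
    Affine Φ hinv hsymm →ₗ⁅ℂ⁆ Module.End ℂ (⨂[ℂ] i, U i) :=
  tensorRep fun i => evalRep Φ hinv hsymm (z i) (U i)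

/-- `(a ⊗ tⁿ)(u₁ ⊗ ⋯ ⊗ u_r) = ∑ᵢ zᵢⁿ (u₁ ⊗ ⋯ ⊗ a uᵢ ⊗ ⋯ ⊗ u_r)`. -/
theorem evaluationModule_loopElt {r : ℕ} (z : Fin r → ℂˣ) (U : Fin r → Type v)
    [∀ i, AddCommGroup (U i)] [∀ i, Module ℂ (U i)] [∀ i, LieRingModule g (U i)]
    [∀ i, LieModule ℂ g (U i)] (a : g) (n : ℤ) (u : ∀ i, U i) :
    evaluationModule Φ hinv hsymm z U (loopElt Φ hinv hsymm a n) (PiTensorProduct.tprod ℂ u) =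
      ∑ i, (z i : ℂ) ^ n • PiTensorProduct.tprod ℂ (Function.update u i ⁅a, u i⁆) := by
  simp [evaluationModule, tensorRep_tprod, evalRep_loopElt]

/-- `k` acts as zero on an evaluation module. -/
theorem evaluationModule_central {r : ℕ} (z : Fin r → ℂˣ) (U : Fin r → Type v)
    [∀ i, AddCommGroup (U i)] [∀ i, Module ℂ (U i)] [∀ i, LieRingModule g (U i)]
    [∀ i, LieModule ℂ g (U i)] :
    evaluationModule Φ hinv hsymm z U (central Φ hinv hsymm) = 0 := by
  refine PiTensorProduct.ext ?_
  ext u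
  simp only [LinearMap.compMultilinearMap_apply, evaluationModule, tensorRep_tprod,
    evalRep_central, LinearMap.zero_apply]
  exact Finset.sum_eq_zero fun i _ => MultilinearMap.map_update_zero _ _ _

end Evaluation

end AffineLie

end

/-! Since $\mathfrak g$ is perfect and the form is nonzero, $\hat{\mathfrak g}$ is spanned by
brackets, so every operator on $W$ has trace zero (`eq_zero_of_map_lie_eq_zero`). The image of
$\hat{\mathfrak g}$ in $\mathrm{End}(W)$ is then irreducible and trace-free, hence has trivial
radical, and any ideal with abelian image acts as zero (`map_eq_zero_of_map_lie_eq_zero`). Applied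
to the center this kills $\mathbf k$, so the action descends to the loop algebra.

Membership in $\mathcal E$ says that $p(t)\,(\mathfrak g\otimes\mathbb C[t,t^{-1}])$ acts as zero.
Let $f$ be $t$ times a product of distinct linear factors covering the nonzero roots of $p$; then
$p$ divides a power of $f$. The same principle, applied to the ideals generated by $f^{2^k}$, lowers
that power to $f$ itself (`map_smul_eq_zero_of_pow`). Hence $a\otimes q(t)$ acts through the values
$q(z_i)$ only, and Lagrange interpolation splits the action as $\sum_i q(z_i)\rho_i(a)$ with
commuting representations $\rho_i$ of $\mathfrak g$ (`exists_rep_of_map_tmul_eq_zero`).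

It remains to factor a space that is irreducible under commuting algebras $A_i$
(`exists_tensorEquiv_of_commuting`). For $w\neq0$ minimising $\sum_i\dim A_iw$, each $A_iw$ is
simple. The map $\bigotimes_i A_iw\to W$, $\bigotimes a_iw\mapsto(\prod a_i)w$, is surjective by
irreducibility and injective by the density theorem. -/

namespace AffineLie

/-! ### Tensor factorisation under commuting algebras. -/

/-- On a simple module over an algebra over an algebraically closed field, every operator of rank
one is realised by the algebra. -/
theorem exists_smul_eq_dual_smul {K : Type*} [Field K] [IsAlgClosed K] {A U : Type*} [Ring A]
    [Algebra K A] [AddCommGroup U] [Module K U] [Module A U] [IsScalarTower K A U]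
    [FiniteDimensional K U] [IsSimpleModule A U]
    (φ : Module.Dual K U) (w : U) : ∃ a : A, ∀ u : U, a • u = φ u • w := by
  have hb := IsSimpleModule.algebraMap_end_bijective_of_isAlgClosed (A := A) (V := U) K
  -- By Schur's lemma the commutant of `A` is `K`, so the rank-one map is linear over the commutant.
  -- Density then realises it on a finite spanning set, which suffices.
  let f : Module.End (Module.End A U) U :=
    { toFun := fun u => φ u • w
      map_add' := fun x y => by rw [map_add, add_smul]
      map_smul' := fun d x => by
        obtain ⟨c, rfl⟩ := hb.2 d
        simp [mul_smul] }
  obtain ⟨s, hs⟩ := (inferInstance : Module.Finite K U).fg_top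
  obtain ⟨a, ha⟩ := jacobson_density f s
  refine ⟨a, fun u => ?_⟩
  have hu : u ∈ Submodule.span K (s : Set U) := hs ▸ Submodule.mem_top
  change a • u = f u
  induction hu using Submodule.span_induction with
  | mem x hx => exact (ha x hx).symm
  | zero => simp
  | add x y _ _ hx hy => rw [smul_add, hx, hy, map_add]
  | smul c x _ hx =>
    rw [smul_algebra_smul_comm, hx]
    simp [f]

section CommutingAlgebras

variable {K : Type*} [Field K] {ι : Type*} [Fintype ι]
  {W : Type*} [AddCommGroup W] [Module K W]
  {A : ι → Type*} [∀ i, Ring (A i)] [∀ i, Algebra K (A i)] [∀ i, Module (A i) W]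
  [∀ i, IsScalarTower K (A i) W]

omit [Fintype ι] in
theorem commute_lsmul
    (hA : ∀ i j, i ≠ j → ∀ (a : A i) (b : A j) (w : W), a • b • w = b • a • w)
    {i j : ι} (hij : i ≠ j) (a : A i) (b : A j) :
    Commute (Algebra.lsmul K K W a) (Algebra.lsmul K K W b) :=
  LinearMap.ext fun w => hA i j hij a b w

variable (hA : ∀ i j, i ≠ j → ∀ (a : A i) (b : A j) (w : W), a • b • w = b • a • w)

variable (K) in
/-- The product of one operator out of each of the commuting algebras `A i`. -/
noncomputable def commProd (a : ∀ i, A i) : Module.End K W :=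
  Finset.noncommProd Finset.univ (fun i => Algebra.lsmul K K W (a i))
    fun _ _ _ _ hij => commute_lsmul hA hij _ _

-- The factors commute, so the `i`-th one can be moved to the right, where it acts first.
variable (K) in
theorem commProd_eq [DecidableEq ι] (i : ι) (a : ∀ i, A i) :
    commProd K hA a = commProd K hA (Function.update a i 1) * Algebra.lsmul K K W (a i) := by
  have h1 := Finset.noncommProd_erase_mul Finset.univ (Finset.mem_univ i)
    (fun j => Algebra.lsmul K K W (a j)) (fun _ _ _ _ hij => commute_lsmul hA hij _ _)
    (fun _ _ _ _ hij => commute_lsmul hA hij _ _)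
  have h2 := Finset.noncommProd_erase_mul Finset.univ (Finset.mem_univ i)
    (fun j => Algebra.lsmul K K W (Function.update a i 1 j))
    (fun _ _ _ _ hij => commute_lsmul hA hij _ _)
    (fun _ _ _ _ hij => commute_lsmul hA hij _ _)
  simp only [Function.update_self, map_one, mul_one] at h2
  unfold commProd
  refine h1.symm.trans ?_
  refine congrArg (· * _) (Eq.trans ?_ h2)
  refine Finset.noncommProd_congr rfl (fun j hj => ?_) _
  rw [Function.update_of_ne (Finset.ne_of_mem_erase hj)]

variable (K) in
theorem commProd_mul (a b : ∀ i, A i) :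
    commProd K hA (fun i => a i * b i) = commProd K hA a * commProd K hA b := by
  refine Eq.trans ?_ (Finset.noncommProd_mul_distrib (fun i => Algebra.lsmul K K W (a i))
    (fun i => Algebra.lsmul K K W (b i)) (fun _ _ _ _ hij => commute_lsmul hA hij _ _)
    (fun _ _ _ _ hij => commute_lsmul hA hij _ _)
    fun _ _ _ _ hij => commute_lsmul hA hij _ _)
  exact Finset.noncommProd_congr rfl (fun i _ => map_mul _ _ _) _

variable (K) in
theorem commProd_one : commProd K hA (fun i => (1 : A i)) = 1 := by
  refine (Finset.noncommProd_eq_pow_card _ _ _ 1 (fun _ _ => map_one _)).trans (one_pow _)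

/-- `commProd a w` depends on `a i` only through `a i • w`. -/
theorem commProd_update_apply [DecidableEq ι] (a : ∀ i, A i) (i : ι) (x : A i) (w : W) :
    commProd K hA (Function.update a i x) w =
      commProd K hA (Function.update a i 1) (x • w) := by
  rw [commProd_eq K hA i]
  simp

/-- Any single factor can be made to act on `w` first, so the `a i` may be exchanged for the `b i`
one index at a time. This makes the orbit map independent of the chosen lifts. -/
theorem commProd_apply_congr (w : W) (a b : ∀ i, A i) (h : ∀ i, a i • w = b i • w) :
    commProd K hA a w = commProd K hA b w := by
  classical
  have key (s : Finset ι) : commProd K hA a w =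
      commProd K hA (fun i => if i ∈ s then b i else a i) w := by
    induction s using Finset.induction_on with
    | empty => simp
    | insert i s hi ih =>
      have h1 : (fun j => if j ∈ insert i s then b j else a j) =
          Function.update (fun j => if j ∈ s then b j else a j) i (b i) := by
        ext1 j
        by_cases hj : j = i
        · subst hj; simp
        · simp [hj]
      have h2 : Function.update (fun j => if j ∈ s then b j else a j) i (a i) =
          fun j => if j ∈ s then b j else a j := by
        rw [Function.update_eq_self_iff]
        simp [hi]
      rw [h1, commProd_update_apply, ← h, ← commProd_update_apply, h2, ih]
  simpa using key Finset.univ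

variable (A) in
/-- The cyclic `A i`-submodule generated by `w`. -/
abbrev cyclic (w : W) (i : ι) : Submodule (A i) W := Submodule.span (A i) {w}

variable (w : W)

variable (A) in
/-- The generator of a cyclic submodule. -/
def cyclicGen (i : ι) : cyclic A w i := ⟨w, Submodule.mem_span_singleton_self w⟩

omit [Fintype ι] in
variable (K A) in
theorem exists_section (i : ι) : ∃ s : cyclic A w i →ₗ[K] A i, ∀ u, s u • w = (u : W) := by
  let f : A i →ₗ[K] cyclic A w i :=
    { toFun := fun a => a • cyclicGen A w i
      map_add' := fun a b => add_smul a b _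
      map_smul' := fun c a => smul_assoc c a _ }
  have hf : Function.Surjective f := fun ⟨u, hu⟩ => by
    obtain ⟨a, ha⟩ := Submodule.mem_span_singleton.1 hu
    exact ⟨a, Subtype.ext ha⟩
  obtain ⟨s, hs⟩ := f.exists_rightInverse_of_surjective (LinearMap.range_eq_top.2 hf)
  exact ⟨s, fun u => congrArg Subtype.val (LinearMap.congr_fun hs u)⟩

variable (K A) in
/-- A linear section of the orbit map `A i → A i w`. -/
noncomputable def orbitSection (i : ι) : cyclic A w i →ₗ[K] A i := (exists_section K A w i).choose

omit [Fintype ι] in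
theorem orbitSection_smul (i : ι) (u : cyclic A w i) : orbitSection K A w i u • w = (u : W) :=
  (exists_section K A w i).choose_spec u

omit [Fintype ι] in
theorem orbitSection_update [DecidableEq ι] (u : ∀ i, cyclic A w i) (i : ι) (x : cyclic A w i) :
    (fun j => orbitSection K A w j (Function.update u i x j)) =
      Function.update (fun j => orbitSection K A w j (u j)) i (orbitSection K A w i x) := by
  ext1 j
  by_cases hj : j = i
  · subst hj; simp
  · simp [hj]

variable (K) in
/-- The multilinear map `(a i w)ᵢ ↦ (∏ a i) w`. -/
noncomputable def orbitMultilinear : MultilinearMap K (fun i => cyclic A w i) W where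
  toFun u := commProd K hA (fun i => orbitSection K A w i (u i)) w
  map_update_add' u i x y := by
    simp only [orbitSection_update]
    rw [commProd_update_apply, commProd_update_apply hA _ i (orbitSection K A w i x),
      commProd_update_apply hA _ i (orbitSection K A w i y), map_add, add_smul, map_add]
  map_update_smul' u i c x := by
    simp only [orbitSection_update]
    rw [commProd_update_apply, commProd_update_apply hA _ i (orbitSection K A w i x),
      LinearMap.map_smul, smul_assoc, LinearMap.map_smul]

theorem orbitMultilinear_eq (a : ∀ i, A i) (u : ∀ i, cyclic A w i)
    (h : ∀ i, a i • w = (u i : W)) : orbitMultilinear K hA w u = commProd K hA a w :=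
  commProd_apply_congr hA w _ _ fun i => (orbitSection_smul w i (u i)).trans (h i).symm

/-- The product of `a i` with a lift of `u i` is a lift of `a i • u i`, and the choice of lifts does
not matter. -/
theorem commProd_orbitMultilinear (a : ∀ i, A i) (u : ∀ i, cyclic A w i) :
    commProd K hA a (orbitMultilinear K hA w u) =
      orbitMultilinear K hA w (fun i => a i • u i) := by
  rw [orbitMultilinear_eq hA w (fun i => a i * orbitSection K A w i (u i)) fun i => a i • u i,
    commProd_mul]
  · rfl
  · intro i
    rw [mul_smul, orbitSection_smul]
    rfl

theorem smul_orbitMultilinear [DecidableEq ι] (i : ι) (a : A i) (u : ∀ i, cyclic A w i) :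
    orbitMultilinear K hA w (Function.update u i (a • u i)) =
      a • orbitMultilinear K hA w u := by
  have h := commProd_orbitMultilinear (K := K) hA w (Function.update (fun _ => 1) i a) u
  have h1 : (fun j => (Function.update (fun j => (1 : A j)) i a) j • u j) =
      Function.update u i (a • u i) := by
    ext1 j
    by_cases hj : j = i
    · subst hj; simp
    · simp [hj]
  have h2 : Function.update (fun j => (1 : A j)) i 1 = fun j => 1 :=
    Function.update_eq_self_iff.2 rfl
  rw [h1] at h
  rw [← h, commProd_update_apply, h2, commProd_one]
  rfl

theorem orbitMultilinear_self : orbitMultilinear K hA w (cyclicGen A w) = w := by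
  rw [orbitMultilinear_eq hA w (fun _ => 1) _ fun i => one_smul _ _, commProd_one]
  rfl

/-- If each cyclic module `A i w` is simple, the orbit map `⨂ A i w → W` is injective. -/
theorem lift_orbitMultilinear_injective [IsAlgClosed K] [FiniteDimensional K W] (hw : w ≠ 0)
    [∀ i, IsSimpleModule (A i) (cyclic A w i)] :
    Function.Injective (PiTensorProduct.lift (orbitMultilinear K hA w)) := by
  classical
  have (i : ι) : FiniteDimensional K (cyclic A w i) :=
    inferInstanceAs (FiniteDimensional K ((cyclic A w i).restrictScalars K))
  rw [injective_iff_map_eq_zero]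
  intro x hx
  let b := fun i => Module.finBasis K (cyclic A w i)
  refine (Basis.piTensorProduct b).ext_elem fun p => ?_
  -- Each `a i` sends a vector of the `i`-th factor to its `p i`-th coordinate times the generator.
  -- The product of the `a i` therefore sends the image of `x` to the `p`-th coordinate of `x` times
  -- `w`, so every coordinate of a kernel element vanishes.
  choose a ha using fun i => exists_smul_eq_dual_smul (A := A i)
    ((b i).coord (p i)) (cyclicGen A w i)
  have key : commProd K hA a ∘ₗ PiTensorProduct.lift (orbitMultilinear K hA w) =
      LinearMap.toSpanSingleton K W w ∘ₗ (Basis.piTensorProduct b).coord p := by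
    refine PiTensorProduct.ext ?_
    ext u
    simp only [LinearMap.compMultilinearMap_apply, LinearMap.comp_apply, PiTensorProduct.lift.tprod,
      LinearMap.toSpanSingleton_apply, Module.Basis.coord_apply,
      Basis.piTensorProduct_repr_tprod_apply, commProd_orbitMultilinear]
    simp only [ha]
    rw [MultilinearMap.map_smul_univ, orbitMultilinear_self]
    rfl
  have h := LinearMap.congr_fun key x
  rw [LinearMap.comp_apply, hx, map_zero] at h
  simpa [hw] using h.symm

include hA in
variable (K) in
/-- There is a vector whose cyclic modules over the commuting algebras are all simple. -/
theorem exists_cyclic_isSimpleModule [FiniteDimensional K W] [Nontrivial W] :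
    ∃ w : W, w ≠ 0 ∧ ∀ i, IsSimpleModule (A i) (cyclic A w i) := by
  let d (w : W) (i : ι) : ℕ := Module.finrank K ((cyclic A w i).restrictScalars K)
  have hne : ∃ n, ∃ w : W, w ≠ 0 ∧ ∑ i, d w i = n := by
    obtain ⟨w, hw⟩ := exists_ne (0 : W)
    exact ⟨_, w, hw, rfl⟩
  classical
  -- Take `w` with the least total dimension of its cyclic modules. A nonzero vector `a • w` in a
  -- proper submodule of the `i`-th one would give a smaller total.
  obtain ⟨w, hw, hwn⟩ := Nat.find_spec hne
  refine ⟨w, hw, fun i => ?_⟩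
  rw [isSimpleModule_iff_isAtom]
  refine ⟨fun h => hw (Submodule.span_singleton_eq_bot.1 h), fun N hN => ?_⟩
  by_contra hN0
  obtain ⟨v, hvN, hv0⟩ := N.ne_bot_iff.1 hN0
  obtain ⟨a, rfl⟩ := Submodule.mem_span_singleton.1 (hN.le hvN)
  refine Nat.find_min hne (m := ∑ j, d (a • w) j) ?_ ⟨_, hv0, rfl⟩
  rw [← hwn]
  refine Finset.sum_lt_sum (fun j _ => ?_) ⟨i, Finset.mem_univ i, ?_⟩
  · by_cases hij : i = j
    · subst hij
      refine Submodule.finrank_mono (show cyclic A (a • w) i ≤ cyclic A w i from ?_)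
      exact (Submodule.span_singleton_le_iff_mem _ _).2
        (Submodule.smul_mem _ _ (Submodule.mem_span_singleton_self w))
    -- For `j ≠ i`, commutation places the cyclic module of `a • w` inside the image under `a` of
    -- that of `w`, so its dimension does not grow.
    · refine (Submodule.finrank_mono ?_).trans (Submodule.finrank_map_le
        (Algebra.lsmul K K W a) ((cyclic A w j).restrictScalars K))
      intro x hx
      obtain ⟨b, rfl⟩ := Submodule.mem_span_singleton.1 hx
      exact ⟨b • w, Submodule.smul_mem _ _ (Submodule.mem_span_singleton_self w), hA i j hij a b w⟩
  · refine Submodule.finrank_lt_finrank_of_lt (lt_of_le_of_lt ?_ (show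
      N.restrictScalars K < (cyclic A w i).restrictScalars K from hN))
    exact (Submodule.span_singleton_le_iff_mem _ _).2 hvN

include hA in
variable (K) in
/-- A finite-dimensional space that is irreducible under finitely many commuting algebras is a
tensor product of modules over these algebras. -/
theorem exists_tensorEquiv_of_commuting [DecidableEq ι] [IsAlgClosed K] [FiniteDimensional K W]
    [Nontrivial W] (hirr : ∀ N : Submodule K W, N ≠ ⊥ →
      (∀ (i : ι) (a : A i), ∀ x ∈ N, a • x ∈ N) → N = ⊤) :
    ∃ (U : ∀ i, Submodule (A i) W) (e : (⨂[K] i, U i) ≃ₗ[K] W), ∀ (i : ι) (a : A i) (u : ∀ i, U i),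
      e (PiTensorProduct.tprod K (Function.update u i (a • u i))) =
        a • e (PiTensorProduct.tprod K u) := by
  obtain ⟨w, hw, hsimple⟩ := exists_cyclic_isSimpleModule K hA
  let μ := PiTensorProduct.lift (orbitMultilinear K hA w)
  have hμ (i : ι) (a : A i) (u : ∀ i, cyclic A w i) :
      μ (PiTensorProduct.tprod K (Function.update u i (a • u i))) =
        a • μ (PiTensorProduct.tprod K u) := by
    simp only [μ, PiTensorProduct.lift.tprod, smul_orbitMultilinear]
  have hsurj : Function.Surjective μ := by
    rw [← LinearMap.range_eq_top]
    -- The range contains `w` and is stable under every `A i`.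
    refine hirr _ (fun h => hw ?_) ?_
    · rw [← Submodule.mem_bot K, ← h]
      exact ⟨PiTensorProduct.tprod K (cyclicGen A w), by
        simp only [μ, PiTensorProduct.lift.tprod, orbitMultilinear_self]⟩
    · rintro i a _ ⟨x, rfl⟩
      induction x using PiTensorProduct.induction_on with
      | smul_tprod c u =>
        rw [map_smul, smul_algebra_smul_comm, ← hμ, ← map_smul]
        exact ⟨_, rfl⟩
      | add x y hx hy =>
        rw [map_add, smul_add]
        exact add_mem hx hy
  exact ⟨cyclic A w, LinearEquiv.ofBijective μ
    ⟨lift_orbitMultilinear_injective hA w hw, hsurj⟩, hμ⟩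

end CommutingAlgebras

/-- A finite-dimensional space that is irreducible under commuting algebras, each of them receiving
a homomorphism from a Lie algebra, is an outer tensor product of representations. -/
theorem exists_tensorEquiv_of_commuting_lieHom {g : Type u} [LieRing g] [LieAlgebra ℂ g]
    {W : Type w} [AddCommGroup W] [Module ℂ W] [FiniteDimensional ℂ W] [Nontrivial W]
    {r : ℕ} {A : Fin r → Type*} [∀ i, Ring (A i)] [∀ i, Algebra ℂ (A i)] [∀ i, Module (A i) W]
    [∀ i, IsScalarTower ℂ (A i) W] (η : ∀ i, g →ₗ⁅ℂ⁆ A i)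
    (hA : ∀ i j, i ≠ j → ∀ (a : A i) (b : A j) (w : W), a • b • w = b • a • w)
    (hirr : ∀ N : Submodule ℂ W, N ≠ ⊥ →
      (∀ (i : Fin r) (x : g), ∀ w ∈ N, η i x • w ∈ N) → N = ⊤) :
    ∃ (U : Fin r → Type w)
      (_ : ∀ i, AddCommGroup (U i)) (_ : ∀ i, Module ℂ (U i))
      (_ : ∀ i, LieRingModule g (U i)) (_ : ∀ i, LieModule ℂ g (U i)),
      (∀ i, FiniteDimensional ℂ (U i)) ∧
        ∃ e : W ≃ₗ[ℂ] ⨂[ℂ] i, U i, ∀ (i : Fin r) (x : g) (w : W),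
          e (η i x • w) = insertOp i (LieModule.toEnd ℂ g (U i) x) (e w) := by
  obtain ⟨U, e, he⟩ := exists_tensorEquiv_of_commuting ℂ hA
    fun N hN h => hirr N hN fun i x w hw => h i (η i x) w hw
  let lieRingModule (i : Fin r) : LieRingModule g (U i) :=
    { bracket := fun x u => η i x • u
      add_lie := fun x y u => by
        change η i (x + y) • u = η i x • u + η i y • u
        rw [map_add, add_smul]
      lie_add := fun x u v => smul_add _ u v
      leibniz_lie := fun x y u => by
        change η i x • η i y • u = η i ⁅x, y⁆ • u + η i y • η i x • u
        rw [← mul_smul, ← mul_smul, ← add_smul, LieHom.map_lie, Ring.lie_def, sub_add_cancel] }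
  have lieModule (i : Fin r) : LieModule ℂ g (U i) :=
    { smul_lie := fun c x u => by
        change η i (c • x) • u = c • η i x • u
        rw [map_smul, smul_assoc]
      lie_smul := fun c x u => smul_algebra_smul_comm c (η i x) u }
  have fd (i : Fin r) : FiniteDimensional ℂ (U i) :=
    inferInstanceAs (FiniteDimensional ℂ ((U i).restrictScalars ℂ))
  refine ⟨fun i => U i, inferInstance, inferInstance, lieRingModule, lieModule, fd, e.symm,
    fun i x w => ?_⟩
  obtain ⟨t, rfl⟩ := e.surjective w
  rw [e.symm_apply_apply, e.symm_apply_eq]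
  have key : Algebra.lsmul ℂ ℂ W (η i x) ∘ₗ e.toLinearMap =
      e.toLinearMap ∘ₗ insertOp i (LieModule.toEnd ℂ g (U i) x) := by
    refine PiTensorProduct.ext ?_
    ext u
    simp only [LinearMap.compMultilinearMap_apply, LinearMap.comp_apply, insertOp_tprod]
    exact (he i (η i x) u).symm
  exact LinearMap.congr_fun key t

/-- A finite-dimensional space that is irreducible under finitely many commuting representations
of a Lie algebra is the outer tensor product of representations. -/
theorem exists_tensorEquiv_of_commuting_rep {g : Type u} [LieRing g] [LieAlgebra ℂ g]
    {W : Type w} [AddCommGroup W] [Module ℂ W] [FiniteDimensional ℂ W] [Nontrivial W]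
    {r : ℕ} (ρ : Fin r → g →ₗ⁅ℂ⁆ Module.End ℂ W)
    (hcomm : ∀ i j, i ≠ j → ∀ x y : g, Commute (ρ i x) (ρ j y))
    (hirr : ∀ N : Submodule ℂ W, N ≠ ⊥ →
      (∀ (i : Fin r) (a : g), ∀ x ∈ N, ρ i a x ∈ N) → N = ⊤) :
    ∃ (U : Fin r → Type w)
      (_ : ∀ i, AddCommGroup (U i)) (_ : ∀ i, Module ℂ (U i))
      (_ : ∀ i, LieRingModule g (U i)) (_ : ∀ i, LieModule ℂ g (U i)),
      (∀ i, FiniteDimensional ℂ (U i)) ∧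
        ∃ e : W ≃ₗ[ℂ] ⨂[ℂ] i, U i, ∀ (i : Fin r) (x : g) (w : W),
          e (ρ i x w) = insertOp i (LieModule.toEnd ℂ g (U i) x) (e w) := by
  let A (i : Fin r) : Subalgebra ℂ (Module.End ℂ W) := Algebra.adjoin ℂ (Set.range (ρ i))
  let η (i : Fin r) : g →ₗ⁅ℂ⁆ A i :=
    { toFun := fun x => ⟨ρ i x, Algebra.subset_adjoin ⟨x, rfl⟩⟩
      map_add' := fun x y => Subtype.ext (map_add (ρ i) x y)
      map_smul' := fun c x => Subtype.ext (map_smul (ρ i) c x)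
      map_lie' := fun {x y} => Subtype.ext (LieHom.map_lie (ρ i) x y) }
  refine exists_tensorEquiv_of_commuting_lieHom η (fun i j hij a b w => ?_) hirr
  -- Commutation passes from generators to the generated algebras, one side at a time.
  have h : Commute (a : Module.End ℂ W) (b : Module.End ℂ W) := by
    refine Algebra.commute_of_mem_adjoin_of_forall_mem_commute b.2 ?_
    rintro _ ⟨y, rfl⟩
    refine (Algebra.commute_of_mem_adjoin_of_forall_mem_commute a.2 ?_).symm
    rintro _ ⟨x, rfl⟩
    exact (hcomm i j hij x y).symm
  exact LinearMap.congr_fun h.eq w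

/-! ### Irreducible trace-free representations. -/

section Irreducible

variable {L : Type*} [LieRing L] [LieAlgebra ℂ L] {W : Type*} [AddCommGroup W] [Module ℂ W]
  [FiniteDimensional ℂ W] [Nontrivial W] (φ : L →ₗ⁅ℂ⁆ Module.End ℂ W)

/-- In an irreducible trace-free representation, an ideal with abelian image acts as zero. -/
theorem map_eq_zero_of_map_lie_eq_zero
    (hirr : ∀ N : Submodule ℂ W, N ≠ ⊥ → (∀ X, ∀ x ∈ N, φ X x ∈ N) → N = ⊤)
    (htr : ∀ X, LinearMap.trace ℂ W (φ X) = 0) (J : LieIdeal ℂ L)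
    (hJ : ∀ x ∈ J, ∀ y ∈ J, φ ⁅x, y⁆ = 0) : ∀ x ∈ J, φ x = 0 := by
  have : LieModule.IsIrreducible ℂ φ.range W := by
    refine LieModule.IsIrreducible.mk fun N hN => ?_
    have h := hirr N (by simpa using hN) fun X x hx =>
      N.lie_mem (x := (⟨φ X, X, rfl⟩ : φ.range)) hx
    simpa using h
  have : LieModule.IsFaithful ℂ φ.range W := by
    rw [LieModule.isFaithful_iff]
    intro x y h
    exact Subtype.ext h
  -- For a faithful irreducible action the radical can consist only of scalars, and a trace-free
  -- scalar is zero.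
  have hrad : LieAlgebra.HasTrivialRadical ℂ φ.range := by
    refine LieAlgebra.hasTrivialRadical_of_isIrreducible_of_isFaithful ℂ φ.range W ?_
    rintro ⟨_, X, rfl⟩
    exact htr X
  rw [LieAlgebra.hasTrivialRadical_iff_no_abelian_ideals] at hrad
  let I : LieIdeal ℂ φ.range :=
    { (J : Submodule ℂ L).map (φ.rangeRestrict : L →ₗ[ℂ] φ.range) with
      lie_mem := by
        rintro ⟨_, X, rfl⟩ _ ⟨y, hy, rfl⟩
        exact ⟨⁅X, y⁆, J.lie_mem hy, Subtype.ext (φ.map_lie X y)⟩ }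
  have hI := hrad I ⟨by
    rintro ⟨_, x, hx, rfl⟩ ⟨_, y, hy, rfl⟩
    refine Subtype.ext (Subtype.ext ?_)
    exact (φ.map_lie x y).symm.trans (hJ x hx y hy)⟩
  intro x hx
  have h : φ.rangeRestrict x ∈ I := ⟨x, hx, rfl⟩
  rw [hI, LieSubmodule.mem_bot] at h
  exact congrArg Subtype.val h

end Irreducible

/-! ### Laurent polynomials and ideals of the loop algebra. -/

section Loop

open Polynomial

variable {g : Type u} [LieRing g] [LieAlgebra ℂ g]

theorem laurentEval_T (z : ℂˣ) (n : ℤ) : laurentEval z (LaurentPolynomial.T n) = (z : ℂ) ^ n := by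
  change laurentEval z (AddMonoidAlgebra.single n 1) = _
  rw [laurentEval, AddMonoidAlgebra.lift_single]
  simp

theorem laurentEval_toLaurent (z : ℂˣ) (f : ℂ[X]) :
    laurentEval z (Polynomial.toLaurent f) = f.eval (z : ℂ) := by
  have h : (laurentEval z).comp Polynomial.toLaurentAlg = Polynomial.aeval (z : ℂ) := by
    ext
    simp [laurentEval_T]
  have h1 := DFunLike.congr_fun h f
  rwa [Polynomial.coe_aeval_eq_eval] at h1

/-- A Laurent polynomial vanishing at finitely many distinct nonzero points is divisible by the
product of the corresponding linear factors. -/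
theorem prod_dvd_of_laurentEval_eq_zero (s : Finset ℂˣ) (f : AddMonoidAlgebra ℂ ℤ)
    (hf : ∀ z ∈ s, laurentEval z f = 0) :
    Polynomial.toLaurent (X * ∏ z ∈ s, (X - C (z : ℂ))) ∣ f := by
  obtain ⟨n, f', hf'⟩ := LaurentPolynomial.exists_T_pow f
  have hdvd : ∏ z ∈ s, (X - C (z : ℂ)) ∣ f' := by
    refine Finset.prod_dvd_of_coprime ?_ ?_
    · intro x _ y _ hxy
      exact Polynomial.pairwise_coprime_X_sub_C Units.val_injective hxy
    · intro z hz
      rw [Polynomial.dvd_iff_isRoot, Polynomial.IsRoot, ← laurentEval_toLaurent, hf']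
      exact (map_mul (laurentEval z) f _).trans (by rw [hf z hz, zero_mul])
  obtain ⟨h, rfl⟩ := hdvd
  -- The `-n` undoes the clearing of denominators. The extra `-1` cancels the factor `X`, a unit
  -- among Laurent polynomials.
  refine ⟨toLaurent h * LaurentPolynomial.T (-n - 1), ?_⟩
  have h2 : f = f * LaurentPolynomial.T n * LaurentPolynomial.T (-n) := by
    rw [mul_assoc, ← LaurentPolynomial.T_add]
    simp
  rw [h2, ← hf', map_mul, map_mul, toLaurent_X,
    show (-n - 1 : ℤ) = -1 + -n by ring, LaurentPolynomial.T_add]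
  have h3 : (LaurentPolynomial.T 1 : LaurentPolynomial ℂ) * LaurentPolynomial.T (-1) = 1 := by
    rw [← LaurentPolynomial.T_add]
    simp
  linear_combination (-(toLaurent (∏ z ∈ s, (X - C (z : ℂ))) * toLaurent h *
    LaurentPolynomial.T (-n))) * h3

/-- Over `ℂ`, `p` is a constant times linear factors, each dividing `q`. The number of roots with
multiplicity serves as exponent. -/
theorem dvd_pow_of_forall_isRoot {p q : ℂ[X]} (hp : p ≠ 0) (h : ∀ a ∈ p.roots, q.IsRoot a) :
    ∃ N, p ∣ q ^ N := by
  refine ⟨p.roots.card, ?_⟩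
  have h1 := (IsAlgClosed.splits p).eq_prod_roots
  have h2 : IsUnit (C p.leadingCoeff) :=
    Polynomial.isUnit_C.2 (isUnit_iff_ne_zero.2 (Polynomial.leadingCoeff_ne_zero.2 hp))
  have h3 : (p.roots.map (X - C ·)).prod ∣ (p.roots.map fun _ => q).prod :=
    Multiset.prod_dvd_prod_of_dvd _ _ fun a ha => Polynomial.dvd_iff_isRoot.2 (h a ha)
  rw [Multiset.map_const', Multiset.prod_replicate] at h3
  exact (dvd_of_eq h1).trans (h2.mul_left_dvd.2 h3)

variable {W : Type*} [AddCommGroup W] [Module ℂ W]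
  (ψ : LieAlgebra.loopAlgebra ℂ ℤ g →ₗ⁅ℂ⁆ Module.End ℂ W)

/-- The ideal `f · (g ⊗ ℂ[t, t⁻¹])` of the loop algebra. -/
def mulIdeal (f : AddMonoidAlgebra ℂ ℤ) : LieIdeal ℂ (LieAlgebra.loopAlgebra ℂ ℤ g) where
  carrier := Set.range fun x : LieAlgebra.loopAlgebra ℂ ℤ g => f • x
  add_mem' := by
    rintro _ _ ⟨x, rfl⟩ ⟨y, rfl⟩
    exact ⟨x + y, smul_add f x y⟩
  zero_mem' := ⟨0, smul_zero f⟩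
  smul_mem' := by
    rintro c _ ⟨x, rfl⟩
    exact ⟨c • x, smul_algebra_smul_comm c f x⟩
  lie_mem := by
    rintro y _ ⟨x, rfl⟩
    exact ⟨⁅y, x⁆, (lie_smul f y x).symm⟩

/-- An irreducible trace-free representation of the loop algebra killed by `f ^ N` is killed
by `f`. -/
theorem map_smul_eq_zero_of_pow [FiniteDimensional ℂ W] [Nontrivial W]
    (hirr : ∀ N : Submodule ℂ W, N ≠ ⊥ → (∀ X, ∀ x ∈ N, ψ X x ∈ N) → N = ⊤)
    (htr : ∀ X, LinearMap.trace ℂ W (ψ X) = 0) (f : AddMonoidAlgebra ℂ ℤ) (N : ℕ)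
    (hf : ∀ x, ψ (f ^ N • x) = 0) : ∀ x, ψ (f • x) = 0 := by
  have key (k : ℕ) (hk : ∀ x, ψ (f ^ 2 ^ k • x) = 0) : ∀ x, ψ (f • x) = 0 := by
    induction k with
    | zero => simpa using hk
    | succ k ih =>
      -- Brackets of two multiples of `f ^ 2 ^ k` are multiples of `f ^ 2 ^ (k + 1)`, so this ideal
      -- has abelian image.
      refine ih fun x => map_eq_zero_of_map_lie_eq_zero ψ hirr htr (mulIdeal (f ^ 2 ^ k)) ?_ _
        ⟨x, rfl⟩
      rintro _ ⟨x, rfl⟩ _ ⟨y, rfl⟩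
      have h := hk ⁅x, y⁆
      rw [pow_succ, pow_mul, pow_two, mul_smul] at h
      exact (congrArg ψ ((smul_lie _ x _).trans (congrArg _ (lie_smul _ x y)))).trans h
  refine key N fun x => ?_
  -- Since `N ≤ 2 ^ N`, the halving may start from the exponent `2 ^ N`.
  rw [← Nat.sub_add_cancel (Nat.lt_two_pow_self (n := N)).le, pow_add, mul_comm, mul_smul]
  exact hf _

end Loop

/-! ### Splitting a loop representation by evaluation points. -/

section LoopDecomposition

open Polynomial

variable {g : Type u} [LieRing g] [LieAlgebra ℂ g] {W : Type*} [AddCommGroup W] [Module ℂ W]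
  (ψ : LieAlgebra.loopAlgebra ℂ ℤ g →ₗ⁅ℂ⁆ Module.End ℂ W)

/-- If the representation `ψ` only depends on the values of Laurent polynomials at distinct points
`z i`, it is a sum of commuting representations of `g` twisted by evaluation. -/
theorem exists_rep_of_map_tmul_eq_zero {r : ℕ} (z : Fin r → ℂˣ) (hz : Function.Injective z)
    (hψ : ∀ f : AddMonoidAlgebra ℂ ℤ, (∀ i, laurentEval (z i) f = 0) →
      ∀ a : g, ψ (f ⊗ₜ[ℂ] a) = 0) :
    ∃ ρ : Fin r → g →ₗ⁅ℂ⁆ Module.End ℂ W,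
      (∀ i j, i ≠ j → ∀ x y : g, Commute (ρ i x) (ρ j y)) ∧
      ∀ (f : AddMonoidAlgebra ℂ ℤ) (a : g), ψ (f ⊗ₜ[ℂ] a) = ∑ i, laurentEval (z i) f • ρ i a := by
  have hz' : Set.InjOn (fun i => (z i : ℂ)) (Finset.univ : Finset (Fin r)) :=
    fun i _ j _ h => hz (Units.ext h)
  -- Modulo functions vanishing at all `z j`, the Lagrange basis consists of orthogonal idempotents.
  -- Idempotence makes each `ρ i` a homomorphism, and orthogonality makes different ones commute.
  let l (i : Fin r) : AddMonoidAlgebra ℂ ℤ :=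
    toLaurent (Lagrange.basis Finset.univ (fun i => (z i : ℂ)) i)
  have hl (i j : Fin r) : laurentEval (z j) (l i) = if i = j then 1 else 0 := by
    rw [laurentEval_toLaurent]
    split_ifs with h
    · subst h
      exact Lagrange.eval_basis_self hz' (Finset.mem_univ i)
    · exact Lagrange.eval_basis_of_ne (v := fun i => (z i : ℂ)) h (Finset.mem_univ j)
  have hcongr (f f' : AddMonoidAlgebra ℂ ℤ) (a : g)
      (h : ∀ i, laurentEval (z i) f = laurentEval (z i) f') :
      ψ (f ⊗ₜ[ℂ] a) = ψ (f' ⊗ₜ[ℂ] a) := by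
    rw [← sub_eq_zero, ← map_sub, ← TensorProduct.sub_tmul]
    exact hψ _ (fun i => by rw [map_sub, h, sub_self]) a
  let ρ (i : Fin r) : g →ₗ⁅ℂ⁆ Module.End ℂ W :=
    { toLinearMap := (ψ : LieAlgebra.loopAlgebra ℂ ℤ g →ₗ[ℂ] Module.End ℂ W) ∘ₗ
        TensorProduct.mk ℂ (AddMonoidAlgebra ℂ ℤ) g (l i)
      map_lie' := by
        intro x y
        change ψ (l i ⊗ₜ[ℂ] ⁅x, y⁆) = ⁅ψ (l i ⊗ₜ[ℂ] x), ψ (l i ⊗ₜ[ℂ] y)⁆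
        rw [← LieHom.map_lie, LieAlgebra.ExtendScalars.bracket_tmul]
        refine hcongr _ _ _ fun j => ?_
        rw [map_mul, hl]
        split_ifs <;> simp }
  refine ⟨ρ, fun i j hij x y => ?_, fun f a => ?_⟩
  · rw [commute_iff_lie_eq]
    change ⁅ψ (l i ⊗ₜ[ℂ] x), ψ (l j ⊗ₜ[ℂ] y)⁆ = 0
    rw [← LieHom.map_lie, LieAlgebra.ExtendScalars.bracket_tmul]
    refine hψ _ (fun k => ?_) _
    rw [map_mul, hl, hl]
    split_ifs with h1 h2
    · exact absurd (h1.trans h2.symm) hij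
    all_goals simp
  · rw [hcongr f (∑ i, laurentEval (z i) f • l i) a, TensorProduct.sum_tmul, map_sum]
    · refine Finset.sum_congr rfl fun i _ => ?_
      rw [← TensorProduct.smul_tmul', map_smul]
      rfl
    · intro j
      rw [map_sum]
      simp [hl]

/-- An irreducible trace-free finite-dimensional representation of the loop algebra annihilated by
a nonzero polynomial is a sum of commuting evaluation representations. -/
theorem exists_rep_of_irreducible [FiniteDimensional ℂ W] [Nontrivial W]
    (hirr : ∀ N : Submodule ℂ W, N ≠ ⊥ → (∀ X, ∀ x ∈ N, ψ X x ∈ N) → N = ⊤)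
    (htr : ∀ X, LinearMap.trace ℂ W (ψ X) = 0) (p : ℂ[X]) (hp : p ≠ 0)
    (hψ : ∀ (f : AddMonoidAlgebra ℂ ℤ) (a : g), ψ ((toLaurent p * f) ⊗ₜ[ℂ] a) = 0) :
    ∃ (r : ℕ) (z : Fin r → ℂˣ) (ρ : Fin r → g →ₗ⁅ℂ⁆ Module.End ℂ W), 0 < r ∧
      Function.Injective z ∧ (∀ i j, i ≠ j → ∀ x y : g, Commute (ρ i x) (ρ j y)) ∧
      ∀ (f : AddMonoidAlgebra ℂ ℤ) (a : g), ψ (f ⊗ₜ[ℂ] a) = ∑ i, laurentEval (z i) f • ρ i a := by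
  classical
  -- Inserting `1` guarantees at least one evaluation point, even when `p` has no nonzero root. The
  -- zero root is handled by the factor `X` below.
  let s : Finset ℂˣ := insert 1
    (p.roots.toFinset.preimage (fun z : ℂˣ => (z : ℂ)) Units.val_injective.injOn)
  obtain ⟨N, q, hq⟩ := dvd_pow_of_forall_isRoot (q := X * ∏ z ∈ s, (X - C (z : ℂ))) hp <| by
    intro a ha
    rw [IsRoot, eval_mul, eval_X, eval_prod, mul_eq_zero, or_iff_not_imp_left]
    intro ha0
    refine Finset.prod_eq_zero (i := Units.mk0 a ha0) ?_ (by simp)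
    exact Finset.mem_insert_of_mem (by simpa using ha)
  have h0 : ∀ x, ψ ((toLaurent (X * ∏ z ∈ s, (X - C (z : ℂ))) : AddMonoidAlgebra ℂ ℤ) • x)
      = 0 := by
    refine map_smul_eq_zero_of_pow ψ hirr htr _ N fun x => ?_
    have h1 : (toLaurent (X * ∏ z ∈ s, (X - C (z : ℂ))) : AddMonoidAlgebra ℂ ℤ) ^ N =
        toLaurent p * toLaurent q := by
      rw [← map_pow, hq, map_mul]
    rw [h1]
    induction x using TensorProduct.induction_on with
    | zero => rw [smul_zero, map_zero]
    | tmul f a =>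
      rw [TensorProduct.smul_tmul', smul_eq_mul, mul_assoc]
      exact hψ _ _
    | add x y hx hy => rw [smul_add, map_add, hx, hy, add_zero]
  let z (i : Fin s.card) : ℂˣ := s.equivFin.symm i
  have hz : Function.Injective z := Subtype.val_injective.comp s.equivFin.symm.injective
  obtain ⟨ρ, h1, h2⟩ := exists_rep_of_map_tmul_eq_zero ψ z hz fun f hf a => by
    obtain ⟨h, rfl⟩ := prod_dvd_of_laurentEval_eq_zero s f fun x hx => by
      simpa [z] using hf (s.equivFin ⟨x, hx⟩)
    have h3 := h0 (h ⊗ₜ[ℂ] a)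
    rwa [TensorProduct.smul_tmul', smul_eq_mul] at h3
  exact ⟨s.card, z, ρ, Finset.card_pos.2 ⟨1, Finset.mem_insert_self _ _⟩, hz, h1, h2⟩

end LoopDecomposition

/-! ### Brackets and representations of the affine algebra. -/

section AffineRep

variable {g : Type u} [LieRing g] [LieAlgebra ℂ g]
  (Φ : LinearMap.BilinForm ℂ g) (hinv : Φ.lieInvariant g) (hsymm : Φ.IsSymm)

/-- The linear section `g ⊗ ℂ[t, t⁻¹] → ĝ` of the projection to the loop algebra. -/
noncomputable def loopIncl : LieAlgebra.loopAlgebra ℂ ℤ g →ₗ[ℂ] Affine Φ hinv hsymm where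
  toFun x := LieAlgebra.ofProd (cocycle Φ hinv hsymm) (x, 0)
  map_add' x y := by
    rw [← LieAlgebra.of_add]
    simp
  map_smul' c x := by
    rw [← LieAlgebra.of_smul]
    simp

theorem loopIncl_single (a : g) (n : ℤ) :
    loopIncl Φ hinv hsymm (AddMonoidAlgebra.single n 1 ⊗ₜ[ℂ] a) = loopElt Φ hinv hsymm a n := rfl

theorem exists_eq_smul_central (X : Affine Φ hinv hsymm) (hX : toLoop Φ hinv hsymm X = 0) :
    ∃ c : ℂ, X = c • central Φ hinv hsymm := by
  obtain ⟨⟨x, c⟩, rfl⟩ := (LieAlgebra.ofProd (cocycle Φ hinv hsymm)).surjective X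
  obtain rfl : x = 0 := hX
  refine ⟨TrivialLieModule.equiv ℂ (LieAlgebra.loopAlgebra ℂ ℤ g) ℂ c, ?_⟩
  rw [central, ← LieAlgebra.of_smul]
  congr 1
  refine Prod.ext (by simp) ?_
  simp [← map_smul]

variable {V : Type*} [AddCommGroup V] [Module ℂ V]

/-- A linear map on `ĝ` killing all brackets vanishes, if `g` is perfect and the form is nonzero. -/
theorem eq_zero_of_map_lie_eq_zero [Nontrivial g] (hnondeg : Φ.Nondegenerate)
    (hperfect : ⁅(⊤ : LieIdeal ℂ g), (⊤ : LieIdeal ℂ g)⁆ = ⊤)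
    (τ : Affine Φ hinv hsymm →ₗ[ℂ] V) (hτ : ∀ X Y : Affine Φ hinv hsymm, τ ⁅X, Y⁆ = 0) : τ = 0 := by
  have hloop (a : g) (n : ℤ) : τ (loopElt Φ hinv hsymm a n) = 0 := by
    have ha : a ∈ LieSubmodule.toSubmodule ⁅(⊤ : LieIdeal ℂ g), (⊤ : LieIdeal ℂ g)⁆ := by
      rw [hperfect]
      exact Submodule.mem_top
    rw [LieSubmodule.lieIdeal_oper_eq_linear_span'] at ha
    induction ha using Submodule.span_induction with
    | mem a ha =>
      obtain ⟨x, -, y, -, rfl⟩ := ha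
      -- With first exponent `0` the cocycle term vanishes.
      have h := hτ (loopElt Φ hinv hsymm x 0) (loopElt Φ hinv hsymm y n)
      simpa [lie_loopElt] using h
    | zero => rw [← loopIncl_single, TensorProduct.tmul_zero, map_zero, map_zero]
    | add x y _ _ hx hy =>
      rw [← loopIncl_single] at hx hy ⊢
      rw [TensorProduct.tmul_add, map_add, map_add, hx, hy, add_zero]
    | smul c x _ hx =>
      rw [← loopIncl_single] at hx ⊢
      rw [TensorProduct.tmul_smul, map_smul, map_smul, hx, smul_zero]
  have hcentral : τ (central Φ hinv hsymm) = 0 := by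
    obtain ⟨a, ha⟩ := exists_ne (0 : g)
    obtain ⟨b, hb⟩ : ∃ b, Φ a b ≠ 0 := by
      by_contra! h
      exact ha (hnondeg.1 a h)
    -- The bracket is a loop element, already killed, plus the nonzero multiple `Φ a b` of the
    -- central element.
    have h := hτ (loopElt Φ hinv hsymm a 1) (loopElt Φ hinv hsymm b (-1))
    simpa [lie_loopElt, hloop, hb] using h
  refine LinearMap.ext_on (span_eq_top Φ hinv hsymm) ?_
  rintro _ (rfl | ⟨⟨a, n⟩, rfl⟩)
  · exact hcentral
  · exact hloop a n

end AffineRep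

open Polynomial

variable {g : Type u} [LieRing g] [LieAlgebra ℂ g]
  (Φ : LinearMap.BilinForm ℂ g) (hinv : Φ.lieInvariant g) (hsymm : Φ.IsSymm)

theorem map_toLaurent_mul_tmul {V : Type*} [AddCommGroup V] [Module ℂ V]
    (ψ : LieAlgebra.loopAlgebra ℂ ℤ g →ₗ[ℂ] V) (p : ℂ[X]) (m : ℤ) (a : g) :
    ψ ((toLaurent p * AddMonoidAlgebra.single m 1 : AddMonoidAlgebra ℂ ℤ) ⊗ₜ[ℂ] a) =
      p.sum fun k c => c • ψ (AddMonoidAlgebra.single (k + m) 1 ⊗ₜ[ℂ] a) := by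
  induction p using Polynomial.induction_on' with
  | add p q hp hq =>
    rw [map_add, add_mul, TensorProduct.add_tmul, map_add, hp, hq, Polynomial.sum_add_index]
    · simp
    · simp [add_smul]
  | monomial k c =>
    rw [Polynomial.sum_monomial_index _ _ (by simp), ← map_smul, TensorProduct.smul_tmul']
    congr 2
    rw [← Polynomial.C_mul_X_pow_eq_monomial, map_mul, Polynomial.toLaurent_C,
      map_pow, Polynomial.toLaurent_X, LaurentPolynomial.T_pow]
    change LaurentPolynomial.C c * LaurentPolynomial.T _ * LaurentPolynomial.T m =
      c • LaurentPolynomial.T _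
    rw [mul_assoc, ← LaurentPolynomial.T_add, LaurentPolynomial.smul_eq_C_mul, mul_one]

/-- Turns the coefficientwise recurrence supplied by the category `ℰ` into annihilation of all
multiples of `p`. -/
theorem map_toLaurent_mul_tmul_eq_zero {V : Type*} [AddCommGroup V] [Module ℂ V]
    (ψ : LieAlgebra.loopAlgebra ℂ ℤ g →ₗ[ℂ] V) (p : ℂ[X]) (a : g)
    (h : ∀ m : ℤ, (p.sum fun k c => c • ψ (AddMonoidAlgebra.single (k + m) 1 ⊗ₜ[ℂ] a)) = 0)
    (f : AddMonoidAlgebra ℂ ℤ) :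
    ψ ((toLaurent p * f : AddMonoidAlgebra ℂ ℤ) ⊗ₜ[ℂ] a) = 0 := by
  induction f using AddMonoidAlgebra.induction_linear with
  | zero => rw [mul_zero, TensorProduct.zero_tmul, map_zero]
  | add f f' hf hf' => rw [mul_add, TensorProduct.add_tmul, map_add, hf, hf', add_zero]
  | single m c =>
    have h1 : (AddMonoidAlgebra.single m c : AddMonoidAlgebra ℂ ℤ) =
        c • AddMonoidAlgebra.single m 1 := by
      rw [AddMonoidAlgebra.smul_single, smul_eq_mul, mul_one]
    rw [h1, mul_smul_comm, ← TensorProduct.smul_tmul', map_smul, map_toLaurent_mul_tmul, h,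
      smul_zero]

/-- A representation of `ĝ` in which `k` acts as zero factors through the loop algebra. -/
theorem exists_loop_rep {W : Type*} [AddCommGroup W] [Module ℂ W]
    (φ : Affine Φ hinv hsymm →ₗ⁅ℂ⁆ Module.End ℂ W) (hk : φ (central Φ hinv hsymm) = 0) :
    ∃ ψ : LieAlgebra.loopAlgebra ℂ ℤ g →ₗ⁅ℂ⁆ Module.End ℂ W,
      ∀ X, φ X = ψ (toLoop Φ hinv hsymm X) := by
  have h0 (X Y : Affine Φ hinv hsymm) (h : toLoop Φ hinv hsymm X = toLoop Φ hinv hsymm Y) :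
      φ X = φ Y := by
    obtain ⟨c, hc⟩ := exists_eq_smul_central Φ hinv hsymm (X - Y) (by rw [map_sub, h, sub_self])
    rw [← sub_eq_zero, ← map_sub, hc, map_smul, hk, smul_zero]
  exact ⟨{
    toLinearMap := (φ : Affine Φ hinv hsymm →ₗ[ℂ] Module.End ℂ W) ∘ₗ loopIncl Φ hinv hsymm
    -- The linear section respects brackets up to a multiple of the central element, which `φ`
    -- kills.
    map_lie' := fun {x y} =>
      (h0 (loopIncl Φ hinv hsymm ⁅x, y⁆) ⁅loopIncl Φ hinv hsymm x, loopIncl Φ hinv hsymm y⁆ rfl).trans (φ.map_lie _ _) },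
    fun X => h0 _ _ rfl⟩

end AffineLie

/-! ### The main theorem. -/

theorem proposition3p16 {g : Type u} [LieRing g] [LieAlgebra ℂ g] [Nontrivial g]
    (Φ : LinearMap.BilinForm ℂ g) (hnondeg : Φ.Nondegenerate)
    (hinv : Φ.lieInvariant g) (hsymm : Φ.IsSymm)
    (hperfect : ⁅(⊤ : LieIdeal ℂ g), (⊤ : LieIdeal ℂ g)⁆ = ⊤)
    {W : Type w} [AddCommGroup W] [Module ℂ W]
    [LieRingModule (AffineLie.Affine Φ hinv hsymm) W]
    [LieModule ℂ (AffineLie.Affine Φ hinv hsymm) W]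
    [FiniteDimensional ℂ W]
    [LieModule.IsIrreducible ℂ (AffineLie.Affine Φ hinv hsymm) W]
    (hE : AffineLie.InCategoryE Φ hinv hsymm W) :
    ∃ (r : ℕ) (z : Fin r → ℂˣ) (U : Fin r → Type w)
      (_ : ∀ i, AddCommGroup (U i)) (_ : ∀ i, Module ℂ (U i))
      (_ : ∀ i, LieRingModule g (U i)) (_ : ∀ i, LieModule ℂ g (U i)),
      0 < r ∧ Function.Injective z ∧ (∀ i, FiniteDimensional ℂ (U i)) ∧
        ∃ e : W ≃ₗ[ℂ] ⨂[ℂ] i, U i, ∀ (X : AffineLie.Affine Φ hinv hsymm) (w : W),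
          e ⁅X, w⁆ = AffineLie.evaluationModule Φ hinv hsymm z U X (e w) := by
  have : Nontrivial W := LieModule.nontrivial_of_isIrreducible ℂ (AffineLie.Affine Φ hinv hsymm) W
  let φ := LieModule.toEnd ℂ (AffineLie.Affine Φ hinv hsymm) W
  have htr (X : AffineLie.Affine Φ hinv hsymm) : LinearMap.trace ℂ W (φ X) = 0 :=
    LinearMap.congr_fun (AffineLie.eq_zero_of_map_lie_eq_zero Φ hinv hsymm hnondeg hperfect
      (LinearMap.trace ℂ W ∘ₗ (φ : AffineLie.Affine Φ hinv hsymm →ₗ[ℂ] Module.End ℂ W))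
      fun X Y => by simp) X
  have hirr (N : Submodule ℂ W) (hN : N ≠ ⊥) (h : ∀ X, ∀ x ∈ N, φ X x ∈ N) : N = ⊤ := by
    let N' : LieSubmodule ℂ (AffineLie.Affine Φ hinv hsymm) W :=
      { N with lie_mem := fun {X x} hx => h X x hx }
    have hN' : (N' : Submodule ℂ W) = N := rfl
    rcases IsSimpleOrder.eq_bot_or_eq_top N' with h1 | h1
    · exact absurd (by rw [← hN', h1, LieSubmodule.bot_toSubmodule]) hN
    · rw [← hN', h1, LieSubmodule.top_toSubmodule]
  have hk : φ (AffineLie.central Φ hinv hsymm) = 0 := by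
    refine AffineLie.map_eq_zero_of_map_lie_eq_zero φ hirr htr (LieAlgebra.center ℂ _)
      (fun x _ y hy => ?_) _ fun X => AffineLie.lie_central Φ hinv hsymm X
    rw [hy x, map_zero]
  obtain ⟨ψ, hψ⟩ := AffineLie.exists_loop_rep Φ hinv hsymm φ hk
  have hψ' (x : LieAlgebra.loopAlgebra ℂ ℤ g) : ψ x = φ (AffineLie.loopIncl Φ hinv hsymm x) :=
    (hψ (AffineLie.loopIncl Φ hinv hsymm x)).symm
  obtain ⟨p, hp, hE⟩ := hE
  obtain ⟨r, z, ρ, hr, hz, hcomm, hρ⟩ := AffineLie.exists_rep_of_irreducible ψ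
    (fun N hN h => hirr N hN fun X x hx => by rw [hψ]; exact h _ x hx)
    (fun X => by rw [hψ']; exact htr _) p hp fun f a => by
      refine AffineLie.map_toLaurent_mul_tmul_eq_zero
        (ψ : LieAlgebra.loopAlgebra ℂ ℤ g →ₗ[ℂ] Module.End ℂ W) p a (fun m => ?_) f
      ext x
      -- The coefficient of `x ^ j` in the generating series carries `t ^ (-j - 1)`, so index `-m -
      -- 1`, shifted down by `k`, gives `t ^ (k + m)`.
      have h := congrFun (hE a x) (-m - 1)
      simp only [AffineLie.polyMul, AffineLie.genSeries] at h
      rw [Polynomial.sum_def, LinearMap.sum_apply]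
      rw [Polynomial.sum_def] at h
      refine Eq.trans (Finset.sum_congr rfl fun k _ => ?_) h
      rw [show -(-m - 1 - (k : ℤ)) - 1 = k + m by ring]
      change p.coeff k • ψ _ x = _
      rw [hψ']
      rfl
  have hφ (a : g) (n : ℤ) : φ (AffineLie.loopElt Φ hinv hsymm a n) =
      ∑ i, (z i : ℂ) ^ n • ρ i a := by
    rw [hψ]
    refine (hρ (LaurentPolynomial.T n) a).trans ?_
    simp only [AffineLie.laurentEval_T]
  obtain ⟨U, i1, i2, i3, i4, hfd, e, he⟩ := AffineLie.exists_tensorEquiv_of_commuting_rep ρ hcomm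
    -- Each spanning element of `ĝ` acts as zero or as a combination of the `ρ i a`, so stability
    -- under the `ρ i` gives stability under `ĝ`.
    fun N hN h => hirr N hN fun X x hx => by
      have hX : X ∈ (⊤ : Submodule ℂ (AffineLie.Affine Φ hinv hsymm)) := Submodule.mem_top
      rw [← AffineLie.span_eq_top Φ hinv hsymm] at hX
      induction hX using Submodule.span_induction with
      | mem X hX =>
        obtain rfl | ⟨⟨a, n⟩, rfl⟩ := hX
        · rw [hk]
          exact N.zero_mem
        · rw [hφ, LinearMap.sum_apply]
          exact N.sum_mem fun i _ => N.smul_mem _ (h i a x hx)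
      | zero => rw [map_zero]; exact N.zero_mem
      | add X Y _ _ hX hY => rw [map_add]; exact N.add_mem hX hY
      | smul c X _ hX => rw [map_smul]; exact N.smul_mem c hX
  refine ⟨r, z, U, i1, i2, i3, i4, hr, hz, hfd, e, fun X w => ?_⟩
  -- Equivariance is stated as an equality of maps linear in `X`, the left side being conjugation of
  -- `φ X` by `e`, so that it can be checked on the spanning set.
  have key : LinearMap.lcomp ℂ _ (e.symm : _ →ₗ[ℂ] W) ∘ₗ LinearMap.compRight ℂ (e : W →ₗ[ℂ] ⨂[ℂ] i, U i) ∘ₗ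
      (φ : AffineLie.Affine Φ hinv hsymm →ₗ[ℂ] Module.End ℂ W) =
      (AffineLie.evaluationModule Φ hinv hsymm z U : _ →ₗ[ℂ] Module.End ℂ (⨂[ℂ] i, U i)) := by
    refine LinearMap.ext_on (AffineLie.span_eq_top Φ hinv hsymm) ?_
    rintro _ (rfl | ⟨⟨a, n⟩, rfl⟩)
    · refine LinearMap.ext fun t => ?_
      change e (φ _ (e.symm t)) = AffineLie.evaluationModule Φ hinv hsymm z U _ t
      rw [hk, AffineLie.evaluationModule_central, LinearMap.zero_apply, LinearMap.zero_apply,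
        map_zero]
    · refine LinearMap.ext fun t => ?_
      change e (φ (AffineLie.loopElt Φ hinv hsymm a n) (e.symm t)) =
        (∑ i, (AffineLie.insertOp i).comp
          (AffineLie.evalRep Φ hinv hsymm (z i) (U i)).toLinearMap) _ t
      simp only [hφ, LinearMap.sum_apply, map_sum, LinearMap.smul_apply, map_smul, he,
        e.apply_symm_apply, LinearMap.comp_apply]
      refine Finset.sum_congr rfl fun i _ => ?_
      rw [← LinearMap.smul_apply, ← map_smul]
      congr 2
      exact (LinearMap.ext fun x => AffineLie.evalRep_loopElt Φ hinv hsymm (z i) a n x).symm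
  have h := LinearMap.congr_fun (LinearMap.congr_fun key X) (e w)
  refine Eq.trans ?_ h
  change _ = e (φ X (e.symm (e w)))
  rw [e.symm_apply_apply]
  rfl
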